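/- **Lemma (Distance-to-FAF bound).** Let $n\ge 1$ and let $\gamma_1,\dots,\gamma_{2n}$ be the Majorana operators of $n$ fermionic modes, realised on $(\mathbb C^2)^{\otimes n}$ by the Jordan–Wigner formulas $\gamma_{2j-1}=\big(\prod_{k<j}Z_k\big)X_j$, $\gamma_{2j}=\big(\prod_{k<j}Z_k\big)Y_j$. For a density operator $\rho$ let $\Gamma_\rho$ be the real antisymmetric $2n\times 2n$ covariance matrix $(\Gamma_\rho)_{ab}=-\tfrac{i}{2}\operatorname{tr}(\rho[\gamma_a,\gamma_b])$, and let $\operatorname{FAF}_1(\rho)=n-\tfrac12\operatorname{tr}(-\Gamma_\rho^2)$ be the first-order fermionic antiflatness. A fermionic Gaussian state is a state of the form $$\rho_G=\frac{\exp\big[-\tfrac i2\sum_{a<b}K_{ab}\gamma_a\gamma_b\big]}{\operatorname{tr}\exp\big[-\tfrac i2\sum_{a<b}K_{ab}\gamma_a\gamma_b\big]},\qquad K=-K^T\in\mathbb R^{2n\times 2n},$$ or a limit of such states; let $\mathcal G_n$ be the set of pure fermionic Gaussian states. For a pure state $\psi=|\psi\rangle\langle\psi|$ with $\|\psi\|=1$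 let $$\epsilon_G(\psi)=\min_{\phi_G\in\mathcal G_n}\tfrac12\big\|\,|\psi\rangle\langle\psi|-|\phi_G\rangle\langle\phi_G|\,\big\|_1$$ be the trace distance from $\psi$ to the closest pure fermionic Gaussian state. Then, for every pure $n$-mode state $\psi$, this minimum is attained and $$\frac{1}{4n}\operatorname{FAF}_1(\psi)\;\le\;\epsilon_G^2(\psi)\;\le\;\frac12\operatorname{FAF}_1(\psi).$$ -/

import Mathlib

open scoped Matrix

noncomputable section

namespace Fermion

/-- Labels of the computational basis of `n` qubits. -/
abbrev Bits (n : ℕ) : Type := Fin n → Fin 2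

/-- Operators on the Hilbert space of `n` qubits (equivalently, `n` fermionic modes). -/
abbrev Op (n : ℕ) : Type := Matrix (Bits n) (Bits n) ℂ

/-- State vectors of `n` qubits, with the Euclidean norm. -/
abbrev Ket (n : ℕ) : Type := EuclideanSpace ℂ (Bits n)

/-- The Pauli matrix `X`. -/
def pauliX : Matrix (Fin 2) (Fin 2) ℂ := !![0, 1; 1, 0]

/-- The Pauli matrix `Y`. -/
def pauliY : Matrix (Fin 2) (Fin 2) ℂ := !![0, -Complex.I; Complex.I, 0]

/-- The Pauli matrix `Z`. -/
def pauliZ : Matrix (Fin 2) (Fin 2) ℂ := !![1, 0; 0, -1]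

/-- The tensor (Kronecker) product of `n` single-qubit operators, the `k`-th one acting on
qubit `k`. -/
def tensor {n : ℕ} (P : Fin n → Matrix (Fin 2) (Fin 2) ℂ) : Op n :=
  Matrix.of fun x y => ∏ k, P k (x k) (y k)

/-- The `2n` Majorana operators in the Jordan-Wigner representation. Qubits and Majorana labels
are counted from `0`: for a qubit `j`, the operator with label `2j` is `(∏_{k<j} Z_k) X_j` and the
one with label `2j+1` is `(∏_{k<j} Z_k) Y_j`. -/
def majorana {n : ℕ} (a : Fin (2 * n)) : Op n :=
  tensor fun k =>
    if (k : ℕ) < (a : ℕ) / 2 then pauliZ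
    else if (k : ℕ) = (a : ℕ) / 2 then (if (a : ℕ) % 2 = 0 then pauliX else pauliY)
    else 1

/-- The unnormalised Gaussian operator `exp[-(i/2) ∑_{a<b} K_{ab} γ_a γ_b]`. -/
def gaussianExp {n : ℕ} (K : Matrix (Fin (2 * n)) (Fin (2 * n)) ℝ) : Op n :=
  NormedSpace.exp (-(Complex.I / 2) •
    ∑ a, ∑ b, if a < b then (K a b : ℂ) • (majorana a * majorana b) else 0)

/-- The Gaussian density operator with (antisymmetric) parameter matrix `K`. -/
def gaussianState {n : ℕ} (K : Matrix (Fin (2 * n)) (Fin (2 * n)) ℝ) : Op n :=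
  (gaussianExp K).trace⁻¹ • gaussianExp K

/-- A fermionic Gaussian state: a density operator `gaussianState K` with `K` real and
antisymmetric, or a limit of such operators. (For finite `K` these operators are invertible, so
that for `n ≥ 1` the pure Gaussian states occur only as limits.) -/
def IsGaussian {n : ℕ} (ρ : Op n) : Prop :=
  ρ ∈ closure {σ : Op n | ∃ K : Matrix (Fin (2 * n)) (Fin (2 * n)) ℝ,
    Kᵀ = -K ∧ σ = gaussianState K}

/-- The rank-one operator `|ψ⟩⟨ψ|`. -/
def ketbra {n : ℕ} (ψ : Ket n) : Op n :=
  Matrix.of fun x y => ψ x * star (ψ y)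

/-- The set of (unit vectors representing) pure fermionic Gaussian states. -/
def pureGaussian (n : ℕ) : Set (Ket n) :=
  {φ | ‖φ‖ = 1 ∧ IsGaussian (ketbra φ)}

/-- The covariance matrix `Γ_{ab} = -(i/2) tr(ρ [γ_a, γ_b])`; this number is real for every
Hermitian `ρ`. -/
def covariance {n : ℕ} (ρ : Op n) : Matrix (Fin (2 * n)) (Fin (2 * n)) ℝ :=
  Matrix.of fun a b =>
    (-(Complex.I / 2) * (ρ * (majorana a * majorana b - majorana b * majorana a)).trace).re

/-- Fermionic antiflatness of order `k`: `FAF_k(ρ) = n - (1/2) tr[(-Γ²)^k]`. -/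
def FAF {n : ℕ} (k : ℕ) (ρ : Op n) : ℝ :=
  n - (1 / 2) * ((-(covariance ρ ^ 2)) ^ k).trace

/-- The trace norm `‖A‖₁`, the sum of the singular values of `A`, i.e. of the square roots of the
eigenvalues of `Aᴴ A` (with multiplicity). -/
def traceNorm {n : ℕ} (A : Op n) : ℝ :=
  ∑ i, Real.sqrt ((Matrix.isHermitian_conjTranspose_mul_self A).eigenvalues i)

/-- The trace distance `(1/2) ‖ρ - σ‖₁`. -/
def traceDist {n : ℕ} (ρ σ : Op n) : ℝ := (1 / 2) * traceNorm (ρ - σ)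

/-- The trace distances from the pure state `ψ` to the pure fermionic Gaussian states. -/
def gaussianDistances {n : ℕ} (ψ : Ket n) : Set ℝ :=
  {d | ∃ φ ∈ pureGaussian n, d = traceDist (ketbra ψ) (ketbra φ)}

/-- The trace distance `ε_G(ψ)` from `ψ` to the closest pure fermionic Gaussian state. -/
def epsG {n : ℕ} (ψ : Ket n) : ℝ := sInf (gaussianDistances ψ)

end Fermion

end

/-!
A Gaussian operator is, in the normal modes `e k, f k` of its parameter matrix, a product
`∏ₖ (1 + tₖ Sₖ) / 2` with `Sₖ = -i γ(e k) γ(f k)` and `|tₖ| ≤ 1`; the limits `tₖ = 1` are pure.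

Lower bound: the product lies below each of its factors, so its overlap `x` with a state of
covariance matrix `Γ` satisfies `x ≤ (1 + tₖ sₖ) / 2`, `sₖ = ⟨e k, Γ f k⟩`. Since
`sₖ² ≥ 2 tₖ sₖ - tₖ² ≥ 4 x - 3` and `∑ₖ sₖ² ≤ n - FAF₁`, this gives `FAF₁ ≤ 4 n (1 - x)`. The
inequality passes to limits, and for pure states `1 - x` is the squared trace distance.

Upper bound: take the normal modes of `Γ` itself, with `sₖ ∈ [0, 1]` its normal-form values, and the
product with all `tₖ = 1`. The union bound for commuting projections gives
`1 - x ≤ ∑ₖ (1 - sₖ) / 2 ≤ ∑ₖ (1 - sₖ²) / 2 = FAF₁ / 2`.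
-/

open scoped ComplexOrder MatrixOrder

namespace Fermion

/-! ### Commuting products -/

section NoncommProd

variable {ι M : Type*} [Monoid M] {s : Finset ι}

theorem commute_noncommProd_of_insert [DecidableEq ι] {f : ι → M} {i : ι} (hi : i ∉ s)
    (comm : ((insert i s : Finset ι) : Set ι).Pairwise (Function.onFun Commute f)) :
    Commute (f i) (s.noncommProd f (comm.mono (by simp))) :=
  Finset.noncommProd_commute _ _ _ _ fun j hj =>
    comm (by simp) (by simp [hj]) (ne_of_mem_of_not_mem hj hi).symm

theorem noncommProd_smul {R : Type*} [CommMonoid R] [MulAction R M] [IsScalarTower R M M]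
    [SMulCommClass R M M] {f : ι → M} (r : ι → R) (s : Finset ι)
    (comm' : (s : Set ι).Pairwise (Function.onFun Commute fun i => r i • f i))
    (comm : (s : Set ι).Pairwise (Function.onFun Commute f)) :
    s.noncommProd (fun i => r i • f i) comm' = (∏ i ∈ s, r i) • s.noncommProd f comm := by
  classical
  induction s using Finset.induction_on with
  | empty => simp
  | insert i s hi ih =>
    have hs : (s : Set ι) ⊆ (insert i s : Finset ι) := by simp
    rw [Finset.noncommProd_insert_of_notMem _ _ _ _ hi,
      Finset.noncommProd_insert_of_notMem _ _ _ _ hi, ih (comm'.mono hs) (comm.mono hs),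
      smul_mul_smul_comm, Finset.prod_insert hi]

theorem continuous_noncommProd {X : Type*} [TopologicalSpace X] [TopologicalSpace M]
    [ContinuousMul M] {f : ι → X → M} (hf : ∀ i, Continuous (f i)) (s : Finset ι)
    (comm : ∀ x, (s : Set ι).Pairwise (Function.onFun Commute fun i => f i x)) :
    Continuous fun x => s.noncommProd (fun i => f i x) (comm x) := by
  classical
  induction s using Finset.induction_on with
  | empty => simpa using continuous_const
  | insert i s hi ih =>
    simp only [Finset.noncommProd_insert_of_notMem _ _ _ _ hi]
    exact (hf i).mul (ih fun x => (comm x).mono (by simp))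

end NoncommProd

theorem isStarProjection_noncommProd {ι A : Type*} [Ring A] [StarRing A] {p : ι → A} {s : Finset ι}
    (hp : ∀ i ∈ s, IsStarProjection (p i))
    (comm : (s : Set ι).Pairwise (Function.onFun Commute p)) :
    IsStarProjection (s.noncommProd p comm) := by
  classical
  induction s using Finset.induction_on with
  | empty => simp [IsStarProjection.one]
  | insert i s hi ih =>
    rw [Finset.noncommProd_insert_of_notMem _ _ _ _ hi]
    exact (hp i (s.mem_insert_self i)).mul (ih (fun j hj => hp j (Finset.mem_insert_of_mem hj)) _)
      (commute_noncommProd_of_insert hi comm)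

section Effects

variable {ι A : Type*} [Ring A] [StarRing A] [PartialOrder A] [StarOrderedRing A]
  [TopologicalSpace A] [Algebra ℝ A] [NonUnitalContinuousFunctionalCalculus ℝ A IsSelfAdjoint]
  [NonnegSpectrumClass ℝ A] {x y : A} {a : ι → A} {s : Finset ι}

theorem mul_le_left_of_commute (hx : 0 ≤ x) (hy : y ≤ 1) (h : Commute x y) : x * y ≤ x := by
  have hnonneg := Commute.mul_nonneg hx (sub_nonneg.mpr hy) ((Commute.one_right x).sub_right h)
  rwa [mul_sub, mul_one, sub_nonneg] at hnonneg

theorem one_sub_mul_le_add (hx : x ≤ 1) (hy : y ≤ 1) (h : Commute x y) :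
    1 - x * y ≤ (1 - x) + (1 - y) := by
  have hnonneg := Commute.mul_nonneg (sub_nonneg.mpr hx) (sub_nonneg.mpr hy)
    ((Commute.one_left _).sub_left ((Commute.one_right x).sub_right h))
  have hexpand : (1 - x) + (1 - y) - (1 - x * y) = (1 - x) * (1 - y) := by noncomm_ring
  rwa [← sub_nonneg, hexpand]

theorem noncommProd_mem_Icc (ha : ∀ i ∈ s, a i ∈ Set.Icc 0 1)
    (comm : (s : Set ι).Pairwise (Function.onFun Commute a)) :
    s.noncommProd a comm ∈ Set.Icc 0 1 := by
  classical
  induction s using Finset.induction_on with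
  | empty => simp
  | insert i s hi ih =>
    have hai := ha i (s.mem_insert_self i)
    have hs := ih (fun j hj => ha j (Finset.mem_insert_of_mem hj)) (comm.mono (by simp))
    have hcomm := commute_noncommProd_of_insert hi comm
    rw [Finset.noncommProd_insert_of_notMem _ _ _ _ hi]
    exact ⟨Commute.mul_nonneg hai.1 hs.1 hcomm,
      (mul_le_left_of_commute hai.1 hs.2 hcomm).trans hai.2⟩

theorem noncommProd_le (ha : ∀ i ∈ s, a i ∈ Set.Icc 0 1)
    (comm : (s : Set ι).Pairwise (Function.onFun Commute a)) {i : ι} (hi : i ∈ s) :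
    s.noncommProd a comm ≤ a i := by
  classical
  have hs : insert i (s.erase i) = s := Finset.insert_erase hi
  have hcomm := commute_noncommProd_of_insert (s.notMem_erase i) (hs.symm ▸ comm)
  rw [← Finset.mul_noncommProd_erase s hi a comm]
  exact mul_le_left_of_commute (ha i hi).1
    (noncommProd_mem_Icc (fun j hj => ha j (Finset.mem_of_mem_erase hj)) _).2 hcomm

theorem one_sub_noncommProd_le_sum (ha : ∀ i ∈ s, a i ∈ Set.Icc 0 1)
    (comm : (s : Set ι).Pairwise (Function.onFun Commute a)) :
    1 - s.noncommProd a comm ≤ ∑ i ∈ s, (1 - a i) := by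
  classical
  induction s using Finset.induction_on with
  | empty => simp
  | insert i s hi ih =>
    have has : ∀ j ∈ s, a j ∈ Set.Icc 0 1 := fun j hj => ha j (Finset.mem_insert_of_mem hj)
    have hcomm : (s : Set ι).Pairwise (Function.onFun Commute a) := comm.mono (by simp)
    rw [Finset.noncommProd_insert_of_notMem _ _ _ _ hi, Finset.sum_insert hi]
    calc 1 - a i * s.noncommProd a hcomm
        ≤ (1 - a i) + (1 - s.noncommProd a hcomm) :=
          one_sub_mul_le_add (ha i (s.mem_insert_self i)).2 (noncommProd_mem_Icc has hcomm).2
            (commute_noncommProd_of_insert hi comm)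
      _ ≤ (1 - a i) + ∑ j ∈ s, (1 - a j) := by gcongr; exact ih has hcomm

end Effects

/-! ### Involutions and product states -/

/-- The element `(1 + t S) / 2`. For an involution `S` it is the projection onto the eigenspace
`S = 1` if `t = 1`, and a multiple of an exponential of `S` if `|t| < 1`. -/
noncomputable def modeState {A : Type*} [Ring A] [Algebra ℝ A] (t : ℝ) (S : A) : A :=
  (1 / 2 : ℝ) • (1 + t • S)

section Involution

variable {A : Type*}

theorem commute_modeState_right [Ring A] [Algebra ℝ A] {c S : A} (h : Commute c S) (t : ℝ) :
    Commute c (modeState t S) :=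
  ((Commute.one_right c).add_right (h.smul_right t)).smul_right _

theorem isStarProjection_modeState_one [Ring A] [StarRing A] [Algebra ℝ A] [StarModule ℝ A] {S : A}
    (hS : IsSelfAdjoint S) (hSS : S * S = 1) : IsStarProjection (modeState 1 S) where
  isIdempotentElem := by
    rw [IsIdempotentElem, modeState, one_smul, smul_mul_smul_comm, add_mul, mul_add, mul_add, hSS,
      one_mul, mul_one, one_mul]
    module
  isSelfAdjoint := by
    rw [modeState, one_smul]
    exact .smul (.all _) (.add (.one A) hS)

theorem one_sub_modeState [Ring A] [Algebra ℝ A] (t : ℝ) (S : A) :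
    1 - modeState t S = modeState (-t) S := by
  rw [modeState, modeState]
  module

theorem modeState_mem_Icc [Ring A] [StarRing A] [Algebra ℝ A] [StarModule ℝ A] [PartialOrder A]
    [StarOrderedRing A] {S : A} (hS : IsSelfAdjoint S) (hSS : S * S = 1) {t : ℝ}
    (ht : t ∈ Set.Icc (-1) 1) : modeState t S ∈ Set.Icc 0 1 := by
  have hnonneg {r : ℝ} (hr : r ∈ Set.Icc (-1) 1) : 0 ≤ modeState r S := by
    have hp := isStarProjection_modeState_one hS hSS
    have hdecomp : modeState r S = ((1 + r) / 2) • modeState 1 S +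
        ((1 - r) / 2) • (1 - modeState 1 S) := by
      simp only [modeState]
      module
    rw [hdecomp]
    exact add_nonneg (smul_nonneg (by linarith [hr.1]) hp.nonneg)
      (smul_nonneg (by linarith [hr.2]) hp.one_sub.nonneg)
  refine ⟨hnonneg ht, ?_⟩
  rw [← sub_nonneg, one_sub_modeState]
  exact hnonneg ⟨neg_le_neg ht.2, neg_le.mp ht.1⟩

theorem continuous_modeState [Ring A] [Algebra ℝ A] [TopologicalSpace A] [ContinuousAdd A]
    [ContinuousSMul ℝ A] (S : A) : Continuous fun t : ℝ => modeState t S := by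
  unfold modeState
  fun_prop

theorem exp_smul_of_mul_self_eq_one [NormedRing A] [NormedAlgebra ℝ A] [CompleteSpace A] {S : A}
    (hS : S * S = 1) (c : ℝ) :
    NormedSpace.exp (c • S) = Real.cosh c • (1 : A) + Real.sinh c • S := by
  have hpow_even (k : ℕ) : S ^ (2 * k) = 1 := by rw [pow_mul, pow_two, hS, one_pow]
  have hpow_odd (k : ℕ) : S ^ (2 * k + 1) = S := by rw [pow_succ, hpow_even, one_mul]
  have hsum := NormedSpace.exp_series_hasSum_exp' (𝕂 := ℝ) (c • S)
  refine hsum.unique (HasSum.even_add_odd ?_ ?_)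
  · convert (Real.hasSum_cosh c).smul_const (1 : A) using 2 with k
    rw [smul_pow, hpow_even, smul_smul, inv_mul_eq_div]
  · convert (Real.hasSum_sinh c).smul_const S using 2 with k
    rw [smul_pow, hpow_odd, smul_smul, inv_mul_eq_div]

theorem exp_smul_eq_smul_modeState [NormedRing A] [NormedAlgebra ℝ A] [CompleteSpace A] {S : A}
    (hS : S * S = 1) (c : ℝ) :
    NormedSpace.exp (c • S) = (2 * Real.cosh c) • modeState (Real.tanh c) S := by
  have hsinh : Real.sinh c = Real.cosh c * Real.tanh c := by
    rw [Real.tanh_eq_sinh_div_cosh, mul_div_cancel₀ _ (Real.cosh_pos c).ne']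
  rw [exp_smul_of_mul_self_eq_one hS, modeState, hsinh]
  module

end Involution

theorem trace_mul_eq_zero_of_anticommute {m R : Type*} [Fintype m] [DecidableEq m] [CommRing R]
    [NoZeroDivisors R] [CharZero R] {S M c : Matrix m m R} (hc : c * c = 1)
    (hcS : c * S = -(S * c)) (hcM : Commute c M) : (S * M).trace = 0 := by
  refine self_eq_neg.mp ?_
  calc (S * M).trace = (c * (c * (S * M))).trace := by rw [← mul_assoc, hc, one_mul]
    _ = (c * (S * M) * c).trace := Matrix.trace_mul_comm _ _
    _ = -(S * M).trace := by
      rw [← mul_assoc, hcS, neg_mul, neg_mul, mul_assoc S, hcM.eq, ← mul_assoc S,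
        mul_assoc (S * M), hc, mul_one, Matrix.trace_neg]

/-- A family of commuting self-adjoint involutions, each of which is flipped (conjugated to its
negative) by an involution that commutes with all the others. For the parities of the normal modes
of a fermionic system the flips are Majorana operators. -/
structure IsModeFamily {ι A : Type*} [Ring A] [StarRing A] (S : ι → A) : Prop where
  isSelfAdjoint : ∀ k, IsSelfAdjoint (S k)
  mul_self : ∀ k, S k * S k = 1
  commute : Pairwise (Function.onFun Commute S)
  exists_flip : ∀ k, ∃ c : A, c * c = 1 ∧ c * S k = -(S k * c) ∧ ∀ l, k ≠ l → Commute c (S l)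

namespace IsModeFamily

variable {ι A : Type*} [Ring A] [StarRing A] [Algebra ℝ A] {S : ι → A}

theorem commute_modeState (hS : IsModeFamily S) (t : ι → ℝ) (s : Set ι) :
    s.Pairwise (Function.onFun Commute fun k => modeState (t k) (S k)) := fun _ _ _ _ hkl =>
  commute_modeState_right (commute_modeState_right (hS.commute hkl).symm _).symm _

theorem trace_noncommProd_modeState {m : Type*} [Fintype m] [DecidableEq m] {S : ι → Matrix m m ℂ}
    (hS : IsModeFamily S) (t : ι → ℝ) (s : Finset ι) :
    (s.noncommProd (fun k => modeState (t k) (S k)) (hS.commute_modeState t s)).trace =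
      (1 / 2) ^ s.card * Fintype.card m := by
  classical
  induction s using Finset.induction_on with
  | empty => simp
  | insert k s hk ih =>
    obtain ⟨c, hc, hcS, hcomm⟩ := hS.exists_flip k
    have htrace : (S k * s.noncommProd _ (hS.commute_modeState t s)).trace = 0 :=
      trace_mul_eq_zero_of_anticommute hc hcS (Finset.noncommProd_commute _ _ _ _ fun l hl =>
        commute_modeState_right (hcomm l (ne_of_mem_of_not_mem hl hk).symm) _)
    rw [Finset.noncommProd_insert_of_notMem _ _ _ _ hk, Finset.card_insert_of_notMem hk,
      modeState, smul_mul_assoc, add_mul, one_mul, smul_mul_assoc, Matrix.trace_smul,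
      Matrix.trace_add, Matrix.trace_smul, htrace, ih, smul_zero, add_zero, Complex.real_smul,
      pow_succ']
    push_cast
    ring

variable [Fintype ι]

/-- The product `∏ₖ (1 + tₖ Sₖ) / 2` of states of the individual modes. -/
noncomputable def productState (hS : IsModeFamily S) (t : ι → ℝ) : A :=
  Finset.univ.noncommProd (fun k => modeState (t k) (S k)) (hS.commute_modeState t _)

theorem continuous_productState [TopologicalSpace A] [IsTopologicalRing A] [ContinuousSMul ℝ A]
    (hS : IsModeFamily S) : Continuous hS.productState :=
  continuous_noncommProd (fun k => (continuous_modeState (S k)).comp (continuous_apply k))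
    Finset.univ fun t => hS.commute_modeState t _

theorem trace_productState {m : Type*} [Fintype m] [DecidableEq m] {S : ι → Matrix m m ℂ}
    (hS : IsModeFamily S) (t : ι → ℝ) :
    (hS.productState t).trace = (1 / 2) ^ Fintype.card ι * Fintype.card m :=
  hS.trace_noncommProd_modeState t Finset.univ

theorem isStarProjection_productState_one [StarModule ℝ A] (hS : IsModeFamily S) :
    IsStarProjection (hS.productState 1) :=
  isStarProjection_noncommProd
    (fun k _ => isStarProjection_modeState_one (hS.isSelfAdjoint k) (hS.mul_self k)) _

section Order

variable [StarModule ℝ A] [PartialOrder A] [StarOrderedRing A] [TopologicalSpace A]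
  [NonUnitalContinuousFunctionalCalculus ℝ A IsSelfAdjoint] [NonnegSpectrumClass ℝ A] {t : ι → ℝ}

theorem productState_le_modeState (hS : IsModeFamily S) (ht : ∀ k, t k ∈ Set.Icc (-1) 1) (k : ι) :
    hS.productState t ≤ modeState (t k) (S k) :=
  noncommProd_le (fun k _ => modeState_mem_Icc (hS.isSelfAdjoint k) (hS.mul_self k) (ht k)) _
    (Finset.mem_univ k)

theorem one_sub_productState_le (hS : IsModeFamily S) (ht : ∀ k, t k ∈ Set.Icc (-1) 1) :
    1 - hS.productState t ≤ ∑ k, (1 - modeState (t k) (S k)) :=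
  one_sub_noncommProd_le_sum
    (fun k _ => modeState_mem_Icc (hS.isSelfAdjoint k) (hS.mul_self k) (ht k)) _

end Order

theorem exp_sum_smul_eq_smul_productState {A : Type*} [NormedRing A] [NormedAlgebra ℝ A]
    [StarRing A] [CompleteSpace A] {S : ι → A} (hS : IsModeFamily S) (c : ι → ℝ) :
    NormedSpace.exp (∑ k, c k • S k) =
      (∏ k, 2 * Real.cosh (c k)) • hS.productState fun k => Real.tanh (c k) := by
  let : NormedAlgebra ℚ A := .restrictScalars ℚ ℝ A
  rw [NormedSpace.exp_sum_of_commute _ _ fun k _ l _ hkl =>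
    ((hS.commute hkl).smul_right _).smul_left _]
  simp only [exp_smul_eq_smul_modeState (hS.mul_self _)]
  exact noncommProd_smul _ Finset.univ _ (hS.commute_modeState _ _)

end IsModeFamily

/-! ### Normal form of skew-symmetric operators -/

section SkewNormalForm

open Module
open scoped InnerProductSpace

variable {E : Type*} [NormedAddCommGroup E] [InnerProductSpace ℝ E]

theorem inner_map_self_of_skew {T : E →ₗ[ℝ] E} (hT : ∀ x y, ⟪T x, y⟫_ℝ = -⟪x, T y⟫_ℝ) (x : E) :
    ⟪T x, x⟫_ℝ = 0 := by
  have h := hT x x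
  rw [real_inner_comm] at h ⊢
  exact self_eq_neg.mp h

theorem orthonormal_sumElim {ι κ : Type*} {v : ι → E} {w : κ → E} (hv : Orthonormal ℝ v)
    (hw : Orthonormal ℝ w) (hvw : ∀ i j, ⟪v i, w j⟫_ℝ = 0) : Orthonormal ℝ (Sum.elim v w) := by
  refine ⟨?_, ?_⟩
  · rintro (i | i)
    exacts [hv.1 i, hw.1 i]
  · rintro (i | i) (j | j) hij
    · exact hv.2 fun h => hij (congrArg _ h)
    · exact hvw i j
    · exact (real_inner_comm _ _).trans (hvw j i)
    · exact hw.2 fun h => hij (congrArg _ h)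

theorem inner_toLpLin_of_transpose_eq_neg {κ : Type*} [Fintype κ] [DecidableEq κ]
    {G : Matrix κ κ ℝ} (hG : Gᵀ = -G) (x y : EuclideanSpace ℝ κ) :
    ⟪Matrix.toLpLin 2 2 G x, y⟫_ℝ = -⟪x, Matrix.toLpLin 2 2 G y⟫_ℝ := by
  simp only [EuclideanSpace.inner_eq_star_dotProduct, Matrix.toLpLin_apply, star_trivial]
  rw [Matrix.dotProduct_mulVec, ← Matrix.mulVec_transpose, hG, Matrix.neg_mulVec, neg_dotProduct]

/-- An orthonormal system `e, f` on which a skew-symmetric operator `T` acts as a rotation by a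
right angle scaled by `l k` in each of the planes spanned by `e k` and `f k`. If it spans the
space, it is a normal form of `T`. -/
structure IsSkewNormalForm {ι : Type*} (T : E →ₗ[ℝ] E) (e f : ι → E) (l : ι → ℝ) : Prop where
  orthonormal_left : Orthonormal ℝ e
  orthonormal_right : Orthonormal ℝ f
  inner_left_right : ∀ i j, ⟪e i, f j⟫_ℝ = 0
  map_left : ∀ k, T (e k) = -l k • f k
  map_right : ∀ k, T (f k) = l k • e k

theorem exists_skew_plane_of_eigenvector {T : E →ₗ[ℝ] E} (hT : ∀ x y, ⟪T x, y⟫_ℝ = -⟪x, T y⟫_ℝ)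
    {f : E} {μ : ℝ} (hf : ‖f‖ = 1) (hTf : T f ≠ 0) (hTT : T (T f) = μ • f) :
    ∃ (e : E) (l : ℝ), ‖e‖ = 1 ∧ ⟪e, f⟫_ℝ = 0 ∧ 0 ≤ l ∧ T e = -l • f ∧ T f = l • e := by
  have hl : ‖T f‖ ≠ 0 := norm_ne_zero_iff.mpr hTf
  have hμ : μ = -‖T f‖ ^ 2 := by
    have h := hT f (T f)
    rw [hTT, inner_smul_right, real_inner_self_eq_norm_sq, real_inner_self_eq_norm_sq, hf] at h
    linarith
  refine ⟨‖T f‖⁻¹ • T f, ‖T f‖, ?_, ?_, norm_nonneg _, ?_, (smul_inv_smul₀ hl _).symm⟩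
  · rw [norm_smul, norm_inv, norm_norm, inv_mul_cancel₀ hl]
  · rw [inner_smul_left, inner_map_self_of_skew hT, mul_zero]
  · rw [map_smul, hTT, hμ, smul_smul, pow_two, mul_neg, inv_mul_cancel_left₀ hl]

theorem mem_orthogonal_span_pair {e f x : E} :
    x ∈ (Submodule.span ℝ {e, f})ᗮ ↔ ⟪e, x⟫_ℝ = 0 ∧ ⟪f, x⟫_ℝ = 0 := by
  have he : e ∈ Submodule.span ℝ {e, f} := Submodule.subset_span (by simp)
  have hf : f ∈ Submodule.span ℝ {e, f} := Submodule.subset_span (by simp)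
  refine ⟨fun hx => ⟨hx e he, hx f hf⟩, fun ⟨hex, hfx⟩ u hu => ?_⟩
  obtain ⟨a, b, rfl⟩ := Submodule.mem_span_pair.mp hu
  simp [inner_add_left, inner_smul_left, hex, hfx]

variable [FiniteDimensional ℝ E]

theorem exists_skew_plane (hE : 2 ≤ finrank ℝ E) {T : E →ₗ[ℝ] E}
    (hT : ∀ x y, ⟪T x, y⟫_ℝ = -⟪x, T y⟫_ℝ) :
    ∃ (e f : E) (l : ℝ), ‖e‖ = 1 ∧ ‖f‖ = 1 ∧ ⟪e, f⟫_ℝ = 0 ∧ 0 ≤ l ∧ T e = -l • f ∧ T f = l • e := by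
  have hTT : (T ∘ₗ T).IsSymmetric := fun x y => by simp only [LinearMap.comp_apply, hT, neg_neg]
  let b := hTT.eigenvectorBasis rfl
  by_cases h0 : ∃ i, T (b i) ≠ 0
  · obtain ⟨i, hi⟩ := h0
    obtain ⟨e, l, he, hef, hl, hTe, hTf⟩ := exists_skew_plane_of_eigenvector hT
      (b.orthonormal.1 i) hi (hTT.apply_eigenvectorBasis rfl i)
    exact ⟨e, b i, l, he, b.orthonormal.1 i, hef, hl, hTe, hTf⟩
  · push Not at h0
    refine ⟨b ⟨0, by omega⟩, b ⟨1, by omega⟩, 0, b.orthonormal.1 _, b.orthonormal.1 _,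
      b.orthonormal.2 (by simp), le_rfl, by simp [h0], by simp [h0]⟩

theorem finrank_orthogonal_span_pair {e f : E} (he : ‖e‖ = 1) (hf : ‖f‖ = 1) (hef : ⟪e, f⟫_ℝ = 0)
    {d : ℕ} (hE : finrank ℝ E = d + 2) : finrank ℝ (Submodule.span ℝ {e, f})ᗮ = d := by
  have hon : Orthonormal ℝ ![e, f] := by
    simp [orthonormal_vecCons_iff, he, hf, hef]
  have hspan : finrank ℝ (Submodule.span ℝ {e, f}) = 2 := by
    rw [← Matrix.range_cons_cons_empty e f ![], finrank_span_eq_card hon.linearIndependent,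
      Fintype.card_fin]
  have hsum := (Submodule.span ℝ {e, f}).finrank_add_finrank_orthogonal
  omega

theorem exists_isSkewNormalForm (m : ℕ) (hE : finrank ℝ E = 2 * m) {T : E →ₗ[ℝ] E}
    (hT : ∀ x y, ⟪T x, y⟫_ℝ = -⟪x, T y⟫_ℝ) :
    ∃ (e f : Fin m → E) (l : Fin m → ℝ), IsSkewNormalForm T e f l ∧ ∀ k, 0 ≤ l k := by
  induction m generalizing E with
  | zero =>
    exact ⟨Fin.elim0, Fin.elim0, Fin.elim0,
      ⟨⟨by simp, by simp⟩, ⟨by simp, by simp⟩, by simp, by simp, by simp⟩, by simp⟩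
  | succ m ih =>
    obtain ⟨e, f, l, he, hf, hef, hl, hTe, hTf⟩ := exists_skew_plane (by omega) hT
    let V : Submodule ℝ E := (Submodule.span ℝ {e, f})ᗮ
    have horth (x : V) : ⟪e, x⟫_ℝ = 0 ∧ ⟪f, x⟫_ℝ = 0 := mem_orthogonal_span_pair.mp x.2
    have hTV (x : E) (hx : x ∈ V) : T x ∈ V := by
      obtain ⟨hex, hfx⟩ := mem_orthogonal_span_pair.mp hx
      refine mem_orthogonal_span_pair.mpr ⟨?_, ?_⟩
      · rw [← neg_eq_zero, ← hT, hTe, inner_smul_left, hfx, mul_zero]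
      · rw [← neg_eq_zero, ← hT, hTf, inner_smul_left, hex, mul_zero]
    have hV : finrank ℝ V = 2 * m := finrank_orthogonal_span_pair he hf hef hE
    obtain ⟨e', f', l', h, hl'⟩ := ih hV (T := T.restrict hTV) fun x y => hT x y
    refine ⟨Matrix.vecCons e fun i => (e' i : E), Matrix.vecCons f fun i => (f' i : E),
      Matrix.vecCons l l', ⟨?_, ?_, ?_, ?_, ?_⟩, Fin.cases hl hl'⟩
    · exact orthonormal_vecCons_iff.mpr
        ⟨he, fun i => (horth (e' i)).1, h.orthonormal_left.comp_linearIsometry V.subtypeₗᵢ⟩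
    · exact orthonormal_vecCons_iff.mpr
        ⟨hf, fun i => (horth (f' i)).2, h.orthonormal_right.comp_linearIsometry V.subtypeₗᵢ⟩
    · exact Fin.cases (Fin.cases hef fun j => (horth (f' j)).1) fun i =>
        Fin.cases ((real_inner_comm _ _).trans (horth (e' i)).2) fun j => h.inner_left_right i j
    · exact Fin.cases hTe fun k => congrArg Subtype.val (h.map_left k)
    · exact Fin.cases hTf fun k => congrArg Subtype.val (h.map_right k)

theorem exists_isSkewNormalForm_toLpLin {ι κ : Type*} [Finite ι] [Fintype κ] [DecidableEq κ]
    {e f : ι → EuclideanSpace ℝ κ} (he : Orthonormal ℝ e) (hf : Orthonormal ℝ f)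
    (hef : ∀ i j, ⟪e i, f j⟫_ℝ = 0) (l : ι → ℝ) :
    ∃ K : Matrix κ κ ℝ, Kᵀ = -K ∧ IsSkewNormalForm (Matrix.toLpLin 2 2 K) e f l := by
  classical
  have := Fintype.ofFinite ι
  let K : Matrix κ κ ℝ := ∑ k, l k • (Matrix.vecMulVec (e k) (f k) - Matrix.vecMulVec (f k) (e k))
  have hmap (x : EuclideanSpace ℝ κ) : Matrix.toLpLin 2 2 K x =
      ∑ k, l k • (⟪f k, x⟫_ℝ • e k - ⟪e k, x⟫_ℝ • f k) := by
    have hvec (u v : EuclideanSpace ℝ κ) :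
        Matrix.toLpLin 2 2 (Matrix.vecMulVec u v) x = ⟪v, x⟫_ℝ • u := by
      ext i
      simp [EuclideanSpace.inner_eq_star_dotProduct, Matrix.vecMulVec_mulVec, dotProduct_comm,
        mul_comm]
    simp only [K, map_sum, map_smul, map_sub, LinearMap.sum_apply, LinearMap.smul_apply,
      LinearMap.sub_apply, hvec]
  refine ⟨K, ?_, he, hf, hef, fun k => ?_, fun k => ?_⟩
  · simp only [K, Matrix.transpose_sum, Matrix.transpose_smul, Matrix.transpose_sub,
      Matrix.transpose_vecMulVec, ← Finset.sum_neg_distrib, ← smul_neg, neg_sub]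
  · simp [hmap, orthonormal_iff_ite.mp he, inner_eq_zero_symm.mp (hef _ _)]
  · simp [hmap, orthonormal_iff_ite.mp hf, hef]

section Trace

variable {ι : Type*} [Fintype ι] {e f : ι → E}

theorem exists_orthonormalBasis_eq_sumElim (he : Orthonormal ℝ e) (hf : Orthonormal ℝ f)
    (hef : ∀ i j, ⟪e i, f j⟫_ℝ = 0) (hE : finrank ℝ E = 2 * Fintype.card ι) :
    ∃ b : OrthonormalBasis (ι ⊕ ι) ℝ E, ⇑b = Sum.elim e f := by
  have hon := orthonormal_sumElim he hf hef
  have hcard : Fintype.card (ι ⊕ ι) = finrank ℝ E := by rw [hE, Fintype.card_sum, two_mul]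
  exact ⟨.mk hon (hon.linearIndependent.span_eq_top_of_card_eq_finrank' hcard).ge,
    OrthonormalBasis.coe_mk hon _⟩

variable {T : E →ₗ[ℝ] E}

theorem trace_comp_self_of_skew (hT : ∀ x y, ⟪T x, y⟫_ℝ = -⟪x, T y⟫_ℝ) (he : Orthonormal ℝ e)
    (hf : Orthonormal ℝ f) (hef : ∀ i j, ⟪e i, f j⟫_ℝ = 0) (hE : finrank ℝ E = 2 * Fintype.card ι) :
    LinearMap.trace ℝ E (T ∘ₗ T) = -∑ k, (‖T (e k)‖ ^ 2 + ‖T (f k)‖ ^ 2) := by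
  obtain ⟨b, hb⟩ := exists_orthonormalBasis_eq_sumElim he hf hef hE
  have hinner (x : E) : ⟪x, T (T x)⟫_ℝ = -‖T x‖ ^ 2 := by
    rw [← neg_eq_iff_eq_neg, ← hT, real_inner_self_eq_norm_sq]
  simp only [LinearMap.trace_eq_sum_inner _ b, Fintype.sum_sum_type, hb, Sum.elim_inl,
    Sum.elim_inr, LinearMap.comp_apply, hinner, Finset.sum_neg_distrib, Finset.sum_add_distrib,
    neg_add]

theorem two_mul_sum_inner_sq_le (hT : ∀ x y, ⟪T x, y⟫_ℝ = -⟪x, T y⟫_ℝ) (he : Orthonormal ℝ e)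
    (hf : Orthonormal ℝ f) (hef : ∀ i j, ⟪e i, f j⟫_ℝ = 0) (hE : finrank ℝ E = 2 * Fintype.card ι) :
    2 * ∑ k, ⟪e k, T (f k)⟫_ℝ ^ 2 ≤ -LinearMap.trace ℝ E (T ∘ₗ T) := by
  rw [trace_comp_self_of_skew hT he hf hef hE, neg_neg, Finset.mul_sum]
  refine Finset.sum_le_sum fun k _ => ?_
  have hleft : ⟪e k, T (f k)⟫_ℝ ^ 2 ≤ ‖T (e k)‖ ^ 2 := by
    rw [← neg_sq, ← hT, sq_le_sq, abs_norm]
    simpa [hf.1 k] using abs_real_inner_le_norm (T (e k)) (f k)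
  have hright : ⟪e k, T (f k)⟫_ℝ ^ 2 ≤ ‖T (f k)‖ ^ 2 := by
    rw [sq_le_sq, abs_norm]
    simpa [he.1 k] using abs_real_inner_le_norm (e k) (T (f k))
  linarith

theorem IsSkewNormalForm.trace_comp_self (hT : ∀ x y, ⟪T x, y⟫_ℝ = -⟪x, T y⟫_ℝ) {l : ι → ℝ}
    (h : IsSkewNormalForm T e f l) (hE : finrank ℝ E = 2 * Fintype.card ι) :
    LinearMap.trace ℝ E (T ∘ₗ T) = -(2 * ∑ k, l k ^ 2) := by
  rw [trace_comp_self_of_skew hT h.orthonormal_left h.orthonormal_right h.inner_left_right hE]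
  simp [h.map_left, h.map_right, norm_smul, h.orthonormal_left.1 _, h.orthonormal_right.1 _,
    ← two_mul, Finset.mul_sum]

end Trace

end SkewNormalForm

/-! ### States and expectation values -/

section Expectation

variable {m : Type*} [Fintype m]

/-- The real part `re tr (ρ A)` of the expectation value of `A` in the state `ρ`, as a real-linear
functional of `A`; the expectation value itself is real for Hermitian `ρ` and `A`. -/
noncomputable def expectation (ρ : Matrix m m ℂ) : Matrix m m ℂ →ₗ[ℝ] ℝ :=
  Complex.reLm ∘ₗ Matrix.traceLinearMap m ℝ ℂ ∘ₗ LinearMap.mulLeft ℝ ρ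

/-- A density operator: a positive semidefinite operator (in the Loewner order) of trace one. -/
structure IsDensityOperator (ρ : Matrix m m ℂ) : Prop where
  nonneg : 0 ≤ ρ
  trace_eq_one : ρ.trace = 1

theorem expectation_apply (ρ A : Matrix m m ℂ) : expectation ρ A = (ρ * A).trace.re := rfl

theorem expectation_comm (A B : Matrix m m ℂ) : expectation A B = expectation B A := by
  rw [expectation_apply, expectation_apply, Matrix.trace_mul_comm]

theorem star_trace_mul {ρ : Matrix m m ℂ} (hρ : IsSelfAdjoint ρ) (A : Matrix m m ℂ) :
    star (ρ * A).trace = (ρ * Aᴴ).trace := by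
  rw [← Matrix.trace_conjTranspose, Matrix.conjTranspose_mul, ← Matrix.star_eq_conjTranspose ρ,
    hρ.star_eq, Matrix.trace_mul_comm]

theorem continuous_expectation (ρ : Matrix m m ℂ) : Continuous (expectation ρ) :=
  LinearMap.continuous_of_finiteDimensional _

theorem coe_expectation {ρ A : Matrix m m ℂ} (hρ : IsSelfAdjoint ρ) (hA : IsSelfAdjoint A) :
    (expectation ρ A : ℂ) = (ρ * A).trace := by
  have h := star_trace_mul hρ A
  rw [← Matrix.star_eq_conjTranspose, hA.star_eq] at h
  exact Complex.conj_eq_iff_re.mp h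

theorem expectation_mono {ρ : Matrix m m ℂ} (hρ : 0 ≤ ρ) : Monotone (expectation ρ) := by
  classical
  intro A B hAB
  obtain ⟨C, rfl⟩ := CStarAlgebra.nonneg_iff_eq_star_mul_self.mp hρ
  have hpos := ((Matrix.le_iff.mp hAB).mul_mul_conjTranspose_same C).trace_nonneg
  rw [← sub_nonneg, ← map_sub, expectation_apply, mul_assoc, Matrix.trace_mul_comm]
  exact (Complex.le_def.mp hpos).1

variable [DecidableEq m]

theorem IsDensityOperator.expectation_one {ρ : Matrix m m ℂ} (hρ : IsDensityOperator ρ) :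
    expectation ρ 1 = 1 := by
  rw [expectation_apply, mul_one, hρ.trace_eq_one, Complex.one_re]

theorem IsDensityOperator.expectation_modeState {ρ : Matrix m m ℂ} (hρ : IsDensityOperator ρ)
    (t : ℝ) (S : Matrix m m ℂ) :
    expectation ρ (modeState t S) = (1 + t * expectation ρ S) / 2 := by
  rw [modeState, map_smul, map_add, map_smul, hρ.expectation_one, smul_eq_mul, smul_eq_mul]
  ring

end Expectation

section Ketbra

variable {n : ℕ} {ψ φ : Ket n}

theorem ketbra_eq_vecMulVec (ψ : Ket n) : ketbra ψ = Matrix.vecMulVec ψ.ofLp (star ψ.ofLp) := by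
  ext x y
  simp [ketbra, Matrix.vecMulVec_apply]

theorem ketbra_nonneg (ψ : Ket n) : 0 ≤ ketbra ψ := by
  rw [ketbra_eq_vecMulVec]
  exact (Matrix.posSemidef_vecMulVec_self_star ψ.ofLp).nonneg

theorem isSelfAdjoint_ketbra (ψ : Ket n) : IsSelfAdjoint (ketbra ψ) := .of_nonneg (ketbra_nonneg ψ)

theorem trace_ketbra (hψ : ‖ψ‖ = 1) : (ketbra ψ).trace = 1 := by
  have hinner := inner_self_eq_norm_sq_to_K (𝕜 := ℂ) ψ
  rw [EuclideanSpace.inner_eq_star_dotProduct, hψ] at hinner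
  simpa [ketbra_eq_vecMulVec, Matrix.trace_vecMulVec] using hinner

theorem ketbra_mul_mul_ketbra (ψ : Ket n) (A : Op n) :
    ketbra ψ * A * ketbra ψ = (ketbra ψ * A).trace • ketbra ψ := by
  rw [Matrix.trace_mul_comm, ketbra_eq_vecMulVec, mul_assoc, Matrix.mul_vecMulVec,
    Matrix.vecMulVec_mul_vecMulVec, Matrix.vecMulVec_smul, Matrix.trace_vecMulVec, dotProduct_comm]

theorem isStarProjection_ketbra (hψ : ‖ψ‖ = 1) : IsStarProjection (ketbra ψ) where
  isIdempotentElem := by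
    simpa [IsIdempotentElem, trace_ketbra hψ] using ketbra_mul_mul_ketbra ψ 1
  isSelfAdjoint := isSelfAdjoint_ketbra ψ

theorem isDensityOperator_ketbra (hψ : ‖ψ‖ = 1) : IsDensityOperator (ketbra ψ) :=
  ⟨ketbra_nonneg ψ, trace_ketbra hψ⟩

theorem continuous_ketbra : Continuous (ketbra : Ket n → Op n) := by
  refine continuous_matrix fun x y => ?_
  simp only [ketbra, Matrix.of_apply]
  fun_prop

theorem mul_ketbra_of_mulVec_eq {p : Op n} (h : p *ᵥ φ.ofLp = φ.ofLp) :
    p * ketbra φ = ketbra φ := by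
  rw [ketbra_eq_vecMulVec, Matrix.mul_vecMulVec, h]

theorem exists_norm_eq_one_and_mulVec_eq {p : Op n} (hp : IsIdempotentElem p) (hne : p ≠ 0) :
    ∃ φ : Ket n, ‖φ‖ = 1 ∧ p *ᵥ φ.ofLp = φ.ofLp := by
  obtain ⟨v, hv⟩ : ∃ v, p *ᵥ v ≠ 0 := by
    contrapose! hne
    exact Matrix.ext_of_mulVec_single fun i => by rw [hne, Matrix.zero_mulVec]
  have hw : WithLp.toLp 2 (p *ᵥ v) ≠ (0 : Ket n) := fun h => hv (congrArg WithLp.ofLp h)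
  refine ⟨(‖WithLp.toLp 2 (p *ᵥ v)‖⁻¹ : ℂ) • WithLp.toLp 2 (p *ᵥ v), norm_smul_inv_norm hw, ?_⟩
  rw [WithLp.ofLp_smul, Matrix.mulVec_smul, Matrix.mulVec_mulVec, hp.eq]

theorem exists_eq_ketbra_of_trace_eq_one {p : Op n} (hp : IsStarProjection p) (ht : p.trace = 1) :
    ∃ φ : Ket n, ‖φ‖ = 1 ∧ p = ketbra φ := by
  have hne : p ≠ 0 := by
    rintro rfl
    simp at ht
  obtain ⟨φ, hφ, hfix⟩ := exists_norm_eq_one_and_mulVec_eq hp.isIdempotentElem hne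
  have hle := (isStarProjection_ketbra hφ).le_of_mul_eq_right hp (mul_ketbra_of_mulVec_eq hfix)
  refine ⟨φ, hφ, sub_eq_zero.mp ((Matrix.le_iff.mp hle).trace_eq_zero_iff.mp ?_)⟩
  rw [Matrix.trace_sub, ht, trace_ketbra hφ, sub_self]

theorem expectation_ketbra_le_one {ρ : Op n} (hρ : IsDensityOperator ρ) (hφ : ‖φ‖ = 1) :
    expectation ρ (ketbra φ) ≤ 1 :=
  hρ.expectation_one ▸ expectation_mono hρ.nonneg (isStarProjection_ketbra hφ).le_one

end Ketbra

/-! ### Trace distance of pure states -/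

section TraceDist

variable {n : ℕ} {ψ φ : Ket n}

theorem eigenvalues_mul_self_eq {m : Type*} [Fintype m] [DecidableEq m] {B : Matrix m m ℂ}
    (hB : B.IsHermitian) {r : ℝ} (h : B * B = r • B) (i : m) :
    hB.eigenvalues i * hB.eigenvalues i = r * hB.eigenvalues i := by
  have : Nonempty m := ⟨i⟩
  have hmem := spectrum.subset_polynomial_aeval B
    (Polynomial.X * Polynomial.X - Polynomial.C r * Polynomial.X)
    ⟨_, hB.eigenvalues_mem_spectrum_real i, rfl⟩
  simpa [h, Algebra.algebraMap_eq_smul_one, sub_eq_zero] using hmem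

theorem traceNorm_eq_trace_div {A : Op n} {s : ℝ} (hs : 0 ≤ s)
    (h : Aᴴ * A * (Aᴴ * A) = s ^ 2 • (Aᴴ * A)) : traceNorm A = (Aᴴ * A).trace.re / s := by
  have hA := Matrix.isHermitian_conjTranspose_mul_self A
  -- For `s = 0` all eigenvalues vanish, and the right-hand side is `0` by `x / 0 = 0`.
  have hsqrt : ∀ i, √(hA.eigenvalues i) = hA.eigenvalues i / s := fun i => by
    rcases mul_eq_mul_right_iff.mp (eigenvalues_mul_self_eq hA h i) with heq | heq
    · rw [heq, Real.sqrt_sq hs, pow_two, mul_self_div_self]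
    · rw [heq, Real.sqrt_zero, zero_div]
  rw [traceNorm, Finset.sum_congr rfl fun i _ => hsqrt i, ← Finset.sum_div,
    hA.trace_eq_sum_eigenvalues]
  simp

theorem ketbra_sub_mul_self (hψ : ‖ψ‖ = 1) (hφ : ‖φ‖ = 1) :
    (ketbra ψ - ketbra φ) * (ketbra ψ - ketbra φ) =
      ketbra ψ + ketbra φ - ketbra ψ * ketbra φ - ketbra φ * ketbra ψ := by
  rw [sub_mul, mul_sub, mul_sub, (isStarProjection_ketbra hψ).isIdempotentElem.eq,
    (isStarProjection_ketbra hφ).isIdempotentElem.eq]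
  abel

theorem ketbra_mul_ketbra_mul_ketbra (ψ φ : Ket n) :
    ketbra ψ * ketbra φ * ketbra ψ = expectation (ketbra ψ) (ketbra φ) • ketbra ψ := by
  rw [ketbra_mul_mul_ketbra, ← coe_expectation (isSelfAdjoint_ketbra ψ) (isSelfAdjoint_ketbra φ),
    Complex.coe_smul]

theorem ketbra_sub_mul_mul_self (hψ : ‖ψ‖ = 1) (hφ : ‖φ‖ = 1) :
    (ketbra ψ - ketbra φ) * ((ketbra ψ - ketbra φ) * (ketbra ψ - ketbra φ)) =
      (1 - expectation (ketbra ψ) (ketbra φ)) • (ketbra ψ - ketbra φ) := by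
  rw [ketbra_sub_mul_self hψ hφ]
  simp only [sub_mul, mul_sub, mul_add, ← mul_assoc, ketbra_mul_ketbra_mul_ketbra,
    (isStarProjection_ketbra hψ).isIdempotentElem.eq,
    (isStarProjection_ketbra hφ).isIdempotentElem.eq, expectation_comm (ketbra φ)]
  module

theorem traceDist_ketbra (hψ : ‖ψ‖ = 1) (hφ : ‖φ‖ = 1) :
    traceDist (ketbra ψ) (ketbra φ) = √(1 - expectation (ketbra ψ) (ketbra φ)) := by
  have hle : 0 ≤ 1 - expectation (ketbra ψ) (ketbra φ) :=
    sub_nonneg.mpr (expectation_ketbra_le_one (isDensityOperator_ketbra hψ) hφ)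
  have hadj : (ketbra ψ - ketbra φ)ᴴ = ketbra ψ - ketbra φ :=
    (isSelfAdjoint_ketbra ψ).sub (isSelfAdjoint_ketbra φ)
  have htrace : ((ketbra ψ - ketbra φ) * (ketbra ψ - ketbra φ)).trace.re =
      2 * (1 - expectation (ketbra ψ) (ketbra φ)) := by
    rw [ketbra_sub_mul_self hψ hφ, Matrix.trace_sub, Matrix.trace_sub, Matrix.trace_add,
      Matrix.trace_mul_comm (ketbra φ), trace_ketbra hψ, trace_ketbra hφ, expectation_apply]
    simp only [Complex.sub_re, Complex.add_re, Complex.one_re]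
    ring
  rw [traceDist, traceNorm_eq_trace_div (Real.sqrt_nonneg _), hadj, htrace, mul_div_assoc,
    Real.div_sqrt]
  · ring
  · rw [hadj, Real.sq_sqrt hle, mul_assoc, ketbra_sub_mul_mul_self hψ hφ, Matrix.mul_smul]

end TraceDist

/-! ### Majorana operators -/

section Tensor

variable {n : ℕ}

theorem tensor_mul (P Q : Fin n → Matrix (Fin 2) (Fin 2) ℂ) :
    tensor P * tensor Q = tensor fun k => P k * Q k := by
  ext x y
  simp only [tensor, Matrix.mul_apply, Matrix.of_apply, ← Finset.prod_mul_distrib]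
  exact (Fintype.prod_sum fun k j => P k (x k) j * Q k j (y k)).symm

theorem tensor_conjTranspose (P : Fin n → Matrix (Fin 2) (Fin 2) ℂ) :
    (tensor P)ᴴ = tensor fun k => (P k)ᴴ := by
  ext x y
  simp [tensor, Matrix.conjTranspose_apply]

theorem tensor_one : tensor (fun _ : Fin n => (1 : Matrix (Fin 2) (Fin 2) ℂ)) = 1 := by
  ext x y
  simp only [tensor, Matrix.of_apply, Matrix.one_apply, Finset.prod_ite_zero, Finset.prod_const_one,
    Finset.mem_univ, true_imp_iff, funext_iff]

theorem tensor_mul_eq_neg {P Q : Fin n → Matrix (Fin 2) (Fin 2) ℂ} (j : Fin n)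
    (hj : P j * Q j = -(Q j * P j)) (h : ∀ k ≠ j, Commute (P k) (Q k)) :
    tensor P * tensor Q = -(tensor Q * tensor P) := by
  rw [tensor_mul, tensor_mul]
  ext x y
  simp only [tensor, Matrix.of_apply, Matrix.neg_apply]
  rw [← Finset.mul_prod_erase _ _ (Finset.mem_univ j),
    ← Finset.mul_prod_erase Finset.univ (fun k => (Q k * P k) (x k) (y k)) (Finset.mem_univ j), hj,
    Matrix.neg_apply, neg_mul]
  congr 2
  refine Finset.prod_congr rfl fun k hk => ?_
  rw [(h k (Finset.ne_of_mem_erase hk)).eq]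

end Tensor

section Pauli

theorem pauliX_mul_self : pauliX * pauliX = 1 := by
  ext i j; fin_cases i <;> fin_cases j <;> simp [pauliX]

theorem pauliY_mul_self : pauliY * pauliY = 1 := by
  ext i j; fin_cases i <;> fin_cases j <;> simp [pauliY]

theorem pauliZ_mul_self : pauliZ * pauliZ = 1 := by
  ext i j; fin_cases i <;> fin_cases j <;> simp [pauliZ]

theorem pauliX_mul_pauliY : pauliX * pauliY = -(pauliY * pauliX) := by
  ext i j; fin_cases i <;> fin_cases j <;> simp [pauliX, pauliY]

theorem pauliX_mul_pauliZ : pauliX * pauliZ = -(pauliZ * pauliX) := by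
  ext i j; fin_cases i <;> fin_cases j <;> simp [pauliX, pauliZ]

theorem pauliY_mul_pauliZ : pauliY * pauliZ = -(pauliZ * pauliY) := by
  ext i j; fin_cases i <;> fin_cases j <;> simp [pauliZ, pauliY]

theorem pauliX_conjTranspose : pauliXᴴ = pauliX := by
  ext i j; fin_cases i <;> fin_cases j <;> simp [pauliX]

theorem pauliY_conjTranspose : pauliYᴴ = pauliY := by
  ext i j; fin_cases i <;> fin_cases j <;> simp [pauliY]

theorem pauliZ_conjTranspose : pauliZᴴ = pauliZ := by
  ext i j; fin_cases i <;> fin_cases j <;> simp [pauliZ]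

end Pauli

section Majorana

variable {n : ℕ}

theorem isSelfAdjoint_majorana (a : Fin (2 * n)) : IsSelfAdjoint (majorana a) := by
  rw [IsSelfAdjoint, Matrix.star_eq_conjTranspose, majorana, tensor_conjTranspose]
  congr 1
  ext1 k
  split_ifs <;> simp [pauliX_conjTranspose, pauliY_conjTranspose, pauliZ_conjTranspose]

theorem majorana_mul_self (a : Fin (2 * n)) : majorana a * majorana a = 1 := by
  rw [majorana, tensor_mul, ← tensor_one]
  congr 1
  ext1 k
  split_ifs <;> simp [pauliX_mul_self, pauliY_mul_self, pauliZ_mul_self]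

theorem majorana_mul_of_lt {a b : Fin (2 * n)} (h : a < b) :
    majorana a * majorana b = -(majorana b * majorana a) := by
  refine tensor_mul_eq_neg ⟨(a : ℕ) / 2, by omega⟩ ?_ fun k hk => ?_
  · simp only [lt_irrefl, if_false, if_true]
    rcases Nat.lt_or_ge ((a : ℕ) / 2) ((b : ℕ) / 2) with hlt | hge
    · rw [if_pos hlt]
      split_ifs
      exacts [pauliX_mul_pauliZ, pauliY_mul_pauliZ]
    · rw [if_neg hge.not_gt, if_pos (by omega : (a : ℕ) / 2 = (b : ℕ) / 2),
        if_pos (by omega : (a : ℕ) % 2 = 0), if_neg (by omega : ¬(b : ℕ) % 2 = 0)]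
      exact pauliX_mul_pauliY
  · have hne : (k : ℕ) ≠ (a : ℕ) / 2 := fun h => hk (Fin.ext h)
    rw [if_neg hne]
    rcases lt_or_gt_of_ne hne with hlt | hgt
    · rw [if_pos hlt, if_pos (by omega)]
    · rw [if_neg hgt.not_gt]
      exact Commute.one_left _

theorem majorana_mul_of_ne {a b : Fin (2 * n)} (h : a ≠ b) :
    majorana a * majorana b = -(majorana b * majorana a) := by
  rcases lt_or_gt_of_ne h with h | h
  · exact majorana_mul_of_lt h
  · rw [majorana_mul_of_lt h, neg_neg]

theorem majorana_anticomm (a b : Fin (2 * n)) :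
    majorana a * majorana b + majorana b * majorana a = if a = b then 2 else 0 := by
  split_ifs with h
  · rw [h, majorana_mul_self, one_add_one_eq_two]
  · rw [majorana_mul_of_ne h, neg_add_cancel]

end Majorana

/-! ### Quadratic Majorana observables and the covariance matrix -/

section Quadratic

open scoped InnerProductSpace

variable {n : ℕ} {u v w : EuclideanSpace ℝ (Fin (2 * n))}

/-- The real linear combination `γ(u) = ∑ u_a γ_a` of the Majorana operators. -/
noncomputable def majoranaSum : EuclideanSpace ℝ (Fin (2 * n)) →ₗ[ℝ] Op n :=
  Fintype.linearCombination ℝ majorana ∘ₗ (WithLp.linearEquiv 2 ℝ (Fin (2 * n) → ℝ)).toLinearMap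

/-- The observable `-i γ(u) γ(v)`, which is Hermitian if `u` and `v` are orthogonal. -/
noncomputable def majoranaBilin (u v : EuclideanSpace ℝ (Fin (2 * n))) : Op n :=
  -Complex.I • (majoranaSum u * majoranaSum v)

theorem majoranaSum_apply (u : EuclideanSpace ℝ (Fin (2 * n))) :
    majoranaSum u = ∑ a, u a • majorana a := rfl

theorem isSelfAdjoint_majoranaSum (u : EuclideanSpace ℝ (Fin (2 * n))) :
    IsSelfAdjoint (majoranaSum u) :=
  isSelfAdjoint_sum _ fun a _ => .smul (.all _) (isSelfAdjoint_majorana a)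

theorem majoranaSum_mul_majoranaSum (u v : EuclideanSpace ℝ (Fin (2 * n))) :
    majoranaSum u * majoranaSum v = ∑ a, ∑ b, (u a * v b) • (majorana a * majorana b) := by
  simp only [majoranaSum_apply, Finset.sum_mul_sum, smul_mul_smul_comm]

theorem majoranaSum_anticomm (u v : EuclideanSpace ℝ (Fin (2 * n))) :
    majoranaSum u * majoranaSum v + majoranaSum v * majoranaSum u = (2 * ⟪u, v⟫_ℝ) • 1 := by
  have hswap : majoranaSum v * majoranaSum u =
      ∑ a, ∑ b, (u a * v b) • (majorana b * majorana a) := by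
    rw [majoranaSum_mul_majoranaSum, Finset.sum_comm]
    simp only [mul_comm (v _)]
  rw [majoranaSum_mul_majoranaSum, hswap]
  simp only [← Finset.sum_add_distrib, ← smul_add, majorana_anticomm, smul_ite, smul_zero,
    Finset.sum_ite_eq, Finset.mem_univ, if_true]
  have htwo : (2 : Op n) = (2 : ℝ) • 1 := by rw [two_smul, one_add_one_eq_two]
  simp only [← Finset.sum_smul, htwo, smul_smul, Finset.mul_sum, PiLp.inner_apply,
    Real.inner_apply, mul_comm]

theorem majoranaSum_mul_self (hu : ‖u‖ = 1) : majoranaSum u * majoranaSum u = 1 := by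
  have h := majoranaSum_anticomm u u
  rw [real_inner_self_eq_norm_sq, hu, one_pow, mul_one, ← two_smul ℝ] at h
  exact smul_right_injective _ (two_ne_zero (α := ℝ)) h

theorem majoranaSum_mul_of_inner_eq_zero (h : ⟪u, v⟫_ℝ = 0) :
    majoranaSum u * majoranaSum v = -(majoranaSum v * majoranaSum u) := by
  rw [eq_neg_iff_add_eq_zero, majoranaSum_anticomm, h, mul_zero, zero_smul]

theorem commute_majoranaSum_majoranaBilin (hu : ⟪w, u⟫_ℝ = 0) (hv : ⟪w, v⟫_ℝ = 0) :
    Commute (majoranaSum w) (majoranaBilin u v) := by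
  refine Commute.smul_right ?_ _
  rw [Commute, SemiconjBy, ← mul_assoc, majoranaSum_mul_of_inner_eq_zero hu, neg_mul, mul_assoc,
    majoranaSum_mul_of_inner_eq_zero hv, mul_neg, neg_neg, mul_assoc]

theorem isSelfAdjoint_majoranaBilin (h : ⟪u, v⟫_ℝ = 0) : IsSelfAdjoint (majoranaBilin u v) := by
  rw [IsSelfAdjoint, majoranaBilin, star_smul, star_mul, (isSelfAdjoint_majoranaSum u).star_eq,
    (isSelfAdjoint_majoranaSum v).star_eq, majoranaSum_mul_of_inner_eq_zero h]
  simp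

theorem majoranaBilin_mul_self (h : ⟪u, v⟫_ℝ = 0) (hu : ‖u‖ = 1) (hv : ‖v‖ = 1) :
    majoranaBilin u v * majoranaBilin u v = 1 := by
  have hsq : majoranaSum u * majoranaSum v * (majoranaSum u * majoranaSum v) = -1 := by
    calc majoranaSum u * majoranaSum v * (majoranaSum u * majoranaSum v)
        = majoranaSum u * (majoranaSum v * majoranaSum u) * majoranaSum v := by noncomm_ring
      _ = -(majoranaSum u * majoranaSum u * (majoranaSum v * majoranaSum v)) := by
        rw [majoranaSum_mul_of_inner_eq_zero (inner_eq_zero_symm.mp h)]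
        noncomm_ring
      _ = -1 := by rw [majoranaSum_mul_self hu, majoranaSum_mul_self hv, mul_one]
  rw [majoranaBilin, smul_mul_smul_comm, hsq]
  simp

theorem majoranaSum_mul_majoranaBilin (h : ⟪u, v⟫_ℝ = 0) :
    majoranaSum u * majoranaBilin u v = -(majoranaBilin u v * majoranaSum u) := by
  rw [majoranaBilin, Matrix.mul_smul, Matrix.smul_mul, ← smul_neg, mul_assoc,
    majoranaSum_mul_of_inner_eq_zero (inner_eq_zero_symm.mp h), mul_neg, neg_neg]

theorem isModeFamily_majoranaBilin {ι : Type*} {e f : ι → EuclideanSpace ℝ (Fin (2 * n))}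
    (he : Orthonormal ℝ e) (hf : Orthonormal ℝ f) (hef : ∀ i j, ⟪e i, f j⟫_ℝ = 0) :
    IsModeFamily fun k => majoranaBilin (e k) (f k) where
  isSelfAdjoint k := isSelfAdjoint_majoranaBilin (hef k k)
  mul_self k := majoranaBilin_mul_self (hef k k) (he.1 k) (hf.1 k)
  commute k l hkl := ((commute_majoranaSum_majoranaBilin (he.2 hkl) (hef k l)).mul_left
    (commute_majoranaSum_majoranaBilin (inner_eq_zero_symm.mp (hef l k)) (hf.2 hkl))).smul_left _
  exists_flip k := ⟨majoranaSum (e k), majoranaSum_mul_self (he.1 k),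
    majoranaSum_mul_majoranaBilin (hef k k),
    fun l hkl => commute_majoranaSum_majoranaBilin (he.2 hkl) (hef k l)⟩

end Quadratic

section Covariance

open scoped InnerProductSpace

variable {n : ℕ} {ρ : Op n}

theorem covariance_transpose (ρ : Op n) : (covariance ρ)ᵀ = -covariance ρ := by
  ext a b
  simp only [covariance, Matrix.transpose_apply, Matrix.neg_apply, Matrix.of_apply]
  rw [← neg_sub (majorana a * majorana b), mul_neg, Matrix.trace_neg, mul_neg, Complex.neg_re]

theorem covariance_self (ρ : Op n) (a : Fin (2 * n)) : covariance ρ a a = 0 := by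
  simp [covariance]

theorem FAF_one_eq_trace (ρ : Op n) :
    FAF 1 ρ = n + 1 / 2 * LinearMap.trace ℝ _
      (Matrix.toLpLin 2 2 (covariance ρ) ∘ₗ Matrix.toLpLin 2 2 (covariance ρ)) := by
  rw [← Matrix.toLpLin_mul_same, Matrix.toLpLin_eq_toLin, Matrix.trace_toLin_eq, FAF, pow_one,
    Matrix.trace_neg, pow_two]
  ring

theorem covariance_eq_expectation (hρ : IsSelfAdjoint ρ) (a b : Fin (2 * n)) :
    covariance ρ a b = expectation ρ (-Complex.I • (majorana a * majorana b)) := by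
  rcases eq_or_ne a b with rfl | hab
  · have htrace : ρ.trace.im = 0 := by
      simpa using congrArg Complex.im (coe_expectation hρ (.one _)).symm
    simp [covariance_self, majorana_mul_self, expectation_apply, htrace]
  · rw [covariance, Matrix.of_apply, majorana_mul_of_ne hab.symm, sub_neg_eq_add, ← two_smul ℂ,
      expectation_apply, Matrix.mul_smul, Matrix.mul_smul, Matrix.trace_smul, Matrix.trace_smul,
      smul_eq_mul, smul_eq_mul, ← mul_assoc]
    congr 2
    ring

theorem expectation_majoranaBilin (hρ : IsSelfAdjoint ρ) (u v : EuclideanSpace ℝ (Fin (2 * n))) :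
    expectation ρ (majoranaBilin u v) = ⟪u, Matrix.toLpLin 2 2 (covariance ρ) v⟫_ℝ := by
  rw [majoranaBilin, majoranaSum_mul_majoranaSum]
  simp only [Finset.smul_sum, map_sum, smul_comm _ (_ : ℝ) (_ : Op n), map_smul,
    ← covariance_eq_expectation hρ]
  simp only [PiLp.inner_apply, Real.inner_apply, Matrix.toLpLin_apply, Matrix.mulVec, dotProduct,
    Finset.mul_sum, smul_eq_mul]
  exact Finset.sum_congr rfl fun a _ => Finset.sum_congr rfl fun b _ => by ring

end Covariance

/-! ### Gaussian states as product states -/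

section Gaussian

open scoped InnerProductSpace

variable {n : ℕ}

theorem gaussianExp_eq_exp_sum {K : Matrix (Fin (2 * n)) (Fin (2 * n)) ℝ} (hK : Kᵀ = -K) :
    gaussianExp K = NormedSpace.exp
      (-(Complex.I / 4) • ∑ a, ∑ b, K a b • (majorana a * majorana b : Op n)) := by
  have hskew : ∀ a b, K b a = -K a b := fun a b => congrFun₂ hK a b
  set g : Fin (2 * n) → Fin (2 * n) → Op n := fun a b =>
    if a < b then (K a b : ℂ) • (majorana a * majorana b) else 0 with hg
  have hsplit : ∀ a b, K a b • (majorana a * majorana b : Op n) = g a b + g b a := fun a b => by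
    rcases lt_trichotomy a b with h | rfl | h
    · simp [hg, h, h.not_gt]
    · simp [hg, self_eq_neg.mp (hskew a a)]
    · simp [hg, h, h.not_gt, hskew a b, majorana_mul_of_lt h]
  have hsum : ∑ a, ∑ b, K a b • (majorana a * majorana b : Op n) =
      (2 : ℂ) • ∑ a, ∑ b, g a b := by
    simp only [hsplit, Finset.sum_add_distrib, two_smul]
    rw [Finset.sum_comm (f := fun a b => g b a)]
  rw [gaussianExp, hsum, smul_smul]
  congr 2
  ring

theorem sum_smul_majorana_mul_majorana {ι : Type*} [Fintype ι]
    (b : OrthonormalBasis ι ℝ (EuclideanSpace ℝ (Fin (2 * n))))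
    (K : Matrix (Fin (2 * n)) (Fin (2 * n)) ℝ) :
    ∑ a, ∑ c, K a c • (majorana a * majorana c : Op n) =
      ∑ i, majoranaSum (Matrix.toLpLin 2 2 K (b i)) * majoranaSum (b i) := by
  have hcol : ∀ c, majoranaSum (Matrix.toLpLin 2 2 K (EuclideanSpace.single c 1)) =
      ∑ a, K a c • (majorana a : Op n) := fun c => by
    simp [majoranaSum_apply, Matrix.toLpLin_apply]
  have hrepr : ∀ c, ∑ i, b i c • b i = EuclideanSpace.single c 1 := fun c => by
    simpa [EuclideanSpace.inner_single_right] using b.sum_repr' (EuclideanSpace.single c 1)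
  calc ∑ a, ∑ c, K a c • (majorana a * majorana c : Op n)
      = ∑ c, majoranaSum (Matrix.toLpLin 2 2 K (∑ i, b i c • b i)) * majorana c := by
        rw [Finset.sum_comm]
        simp only [hrepr, hcol, Finset.sum_mul, smul_mul_assoc]
    _ = ∑ i, majoranaSum (Matrix.toLpLin 2 2 K (b i)) * majoranaSum (b i) := by
        simp only [map_sum, map_smul, Finset.sum_mul, smul_mul_assoc]
        rw [Finset.sum_comm]
        simp only [majoranaSum_apply (b _), Finset.mul_sum, mul_smul_comm]

theorem trace_productState_eq_one {S : Fin n → Op n} (hS : IsModeFamily S) (t : Fin n → ℝ) :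
    (hS.productState t).trace = 1 := by
  rw [hS.trace_productState]
  simp

variable {K : Matrix (Fin (2 * n)) (Fin (2 * n)) ℝ} {e f : Fin n → EuclideanSpace ℝ (Fin (2 * n))}
  {l : Fin n → ℝ}

namespace IsSkewNormalForm

theorem isModeFamily (h : IsSkewNormalForm (Matrix.toLpLin 2 2 K) e f l) :
    IsModeFamily fun k => (majoranaBilin (e k) (f k) : Op n) :=
  isModeFamily_majoranaBilin h.orthonormal_left h.orthonormal_right h.inner_left_right

theorem gaussianExp_eq (hK : Kᵀ = -K) (h : IsSkewNormalForm (Matrix.toLpLin 2 2 K) e f l) :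
    gaussianExp K = NormedSpace.exp (∑ k, (l k / 2) • (majoranaBilin (e k) (f k) : Op n)) := by
  obtain ⟨b, hb⟩ := exists_orthonormalBasis_eq_sumElim h.orthonormal_left h.orthonormal_right
    h.inner_left_right (by simp)
  have hterm : ∀ k, majoranaSum (Matrix.toLpLin 2 2 K (e k)) * majoranaSum (e k) +
      majoranaSum (Matrix.toLpLin 2 2 K (f k)) * majoranaSum (f k) =
        (2 * l k) • (majoranaSum (e k) * majoranaSum (f k)) := fun k => by
    rw [h.map_left, h.map_right, map_smul, map_smul, smul_mul_assoc, smul_mul_assoc,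
      majoranaSum_mul_of_inner_eq_zero (inner_eq_zero_symm.mp (h.inner_left_right k k))]
    module
  rw [gaussianExp_eq_exp_sum hK, sum_smul_majorana_mul_majorana b, hb, Fintype.sum_sum_type]
  simp only [Sum.elim_inl, Sum.elim_inr, ← Finset.sum_add_distrib, hterm, Finset.smul_sum,
    majoranaBilin]
  congr 1
  refine Finset.sum_congr rfl fun k _ => ?_
  module

open scoped Matrix.Norms.Operator in
theorem gaussianState_eq_productState (hK : Kᵀ = -K)
    (h : IsSkewNormalForm (Matrix.toLpLin 2 2 K) e f l) :
    gaussianState K = h.isModeFamily.productState fun k => Real.tanh (l k / 2) := by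
  have hexp : gaussianExp K = (∏ k, 2 * Real.cosh (l k / 2)) •
      h.isModeFamily.productState fun k => Real.tanh (l k / 2) := by
    rw [h.gaussianExp_eq hK]
    exact h.isModeFamily.exp_sum_smul_eq_smul_productState _
  have hne : ∏ k, 2 * Real.cosh (l k / 2) ≠ 0 :=
    Finset.prod_ne_zero_iff.mpr fun k _ => mul_ne_zero two_ne_zero (Real.cosh_pos _).ne'
  rw [gaussianState, hexp, Matrix.trace_smul, trace_productState_eq_one,
    Complex.real_smul, mul_one, ← Complex.coe_smul, smul_smul,
    inv_mul_cancel₀ (Complex.ofReal_ne_zero.mpr hne), one_smul]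

end IsSkewNormalForm

theorem isGaussian_productState (he : Orthonormal ℝ e) (hf : Orthonormal ℝ f)
    (hef : ∀ i j, ⟪e i, f j⟫_ℝ = 0) {t : Fin n → ℝ} (ht : ∀ k, t k ∈ Set.Icc (-1) 1) :
    IsGaussian ((isModeFamily_majoranaBilin he hf hef).productState t) := by
  have hmem : t ∈ closure (Set.univ.pi fun _ : Fin n => Set.Ioo (-1 : ℝ) 1) := by
    simpa only [closure_pi_set, closure_Ioo (show (-1 : ℝ) ≠ 1 by norm_num), Set.mem_univ_pi]
      using ht
  refine map_mem_closure (isModeFamily_majoranaBilin he hf hef).continuous_productState hmem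
    fun s hs => ?_
  obtain ⟨K, hK, h⟩ := exists_isSkewNormalForm_toLpLin he hf hef fun k => 2 * Real.artanh (s k)
  refine ⟨K, hK, ?_⟩
  rw [h.gaussianState_eq_productState hK]
  congr 1
  ext k
  rw [mul_div_cancel_left₀ _ two_ne_zero, Real.tanh_artanh (hs k trivial)]

end Gaussian

/-! ### Overlap with Gaussian states -/

section Overlap

open scoped InnerProductSpace

variable {n : ℕ} {ρ σ : Op n}

variable {e f : Fin n → EuclideanSpace ℝ (Fin (2 * n))}

theorem FAF_one_le_of_orthonormal (he : Orthonormal ℝ e) (hf : Orthonormal ℝ f)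
    (hef : ∀ i j, ⟪e i, f j⟫_ℝ = 0) (ρ : Op n) :
    FAF 1 ρ ≤ ∑ k, (1 - ⟪e k, Matrix.toLpLin 2 2 (covariance ρ) (f k)⟫_ℝ ^ 2) := by
  have h := two_mul_sum_inner_sq_le
    (inner_toLpLin_of_transpose_eq_neg (covariance_transpose ρ)) he hf hef (by simp)
  rw [FAF_one_eq_trace, Finset.sum_sub_distrib]
  simp only [Finset.sum_const, Finset.card_univ, Fintype.card_fin, nsmul_one]
  linarith

theorem FAF_one_eq_sum {l : Fin n → ℝ}
    (h : IsSkewNormalForm (Matrix.toLpLin 2 2 (covariance ρ)) e f l) :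
    FAF 1 ρ = ∑ k, (1 - l k ^ 2) := by
  rw [FAF_one_eq_trace, h.trace_comp_self
    (inner_toLpLin_of_transpose_eq_neg (covariance_transpose ρ)) (by simp), Finset.sum_sub_distrib]
  simp only [Finset.sum_const, Finset.card_univ, Fintype.card_fin, nsmul_one]
  ring

theorem FAF_one_le_of_productState (hρ : IsDensityOperator ρ) (he : Orthonormal ℝ e)
    (hf : Orthonormal ℝ f) (hef : ∀ i j, ⟪e i, f j⟫_ℝ = 0) {t : Fin n → ℝ}
    (ht : ∀ k, t k ∈ Set.Icc (-1) 1) :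
    FAF 1 ρ ≤ 4 * n *
      (1 - expectation ρ ((isModeFamily_majoranaBilin he hf hef).productState t)) := by
  set hS := isModeFamily_majoranaBilin he hf hef
  have hterm : ∀ k, 1 - ⟪e k, Matrix.toLpLin 2 2 (covariance ρ) (f k)⟫_ℝ ^ 2 ≤
      4 * (1 - expectation ρ (hS.productState t)) := fun k => by
    have hle := expectation_mono hρ.nonneg (hS.productState_le_modeState ht k)
    rw [hρ.expectation_modeState, expectation_majoranaBilin (.of_nonneg hρ.nonneg)] at hle
    -- `s² ≥ 2 t s - t²` turns the bound linear in `s` into a quadratic one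
    nlinarith [sq_nonneg (t k - ⟪e k, Matrix.toLpLin 2 2 (covariance ρ) (f k)⟫_ℝ),
      sq_le_one_iff_abs_le_one (t k) |>.mpr (abs_le.mpr (ht k))]
  refine (FAF_one_le_of_orthonormal he hf hef ρ).trans
    ((Finset.sum_le_card_nsmul _ _ _ fun k _ => hterm k).trans_eq ?_)
  rw [Finset.card_univ, Fintype.card_fin, nsmul_eq_mul]
  ring

theorem FAF_one_le_of_gaussianState (hρ : IsDensityOperator ρ)
    {K : Matrix (Fin (2 * n)) (Fin (2 * n)) ℝ} (hK : Kᵀ = -K) :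
    FAF 1 ρ ≤ 4 * n * (1 - expectation ρ (gaussianState K)) := by
  obtain ⟨e, f, l, h, -⟩ := exists_isSkewNormalForm n finrank_euclideanSpace_fin
    (inner_toLpLin_of_transpose_eq_neg hK)
  rw [h.gaussianState_eq_productState hK]
  exact FAF_one_le_of_productState hρ h.orthonormal_left h.orthonormal_right h.inner_left_right
    fun k => ⟨(Real.neg_one_lt_tanh _).le, (Real.tanh_lt_one _).le⟩

theorem IsGaussian.FAF_one_le (hσ : IsGaussian σ) (hρ : IsDensityOperator ρ) :
    FAF 1 ρ ≤ 4 * n * (1 - expectation ρ σ) := by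
  have hclosed : IsClosed {σ | FAF 1 ρ ≤ 4 * n * (1 - expectation ρ σ)} :=
    isClosed_le continuous_const
      (continuous_const.mul (continuous_const.sub (continuous_expectation ρ)))
  refine closure_minimal ?_ hclosed hσ
  rintro _ ⟨K, hK, rfl⟩
  exact FAF_one_le_of_gaussianState hρ hK

theorem exists_pureGaussian_one_sub_expectation_le (hρ : IsDensityOperator ρ) :
    ∃ φ ∈ pureGaussian n, 1 - expectation ρ (ketbra φ) ≤ 1 / 2 * FAF 1 ρ := by
  obtain ⟨e, f, l, h, hl⟩ := exists_isSkewNormalForm n finrank_euclideanSpace_fin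
    (inner_toLpLin_of_transpose_eq_neg (covariance_transpose ρ))
  have hS := h.isModeFamily
  have hone : ∀ k : Fin n, (1 : Fin n → ℝ) k ∈ Set.Icc (-1) 1 := fun _ => by simp
  obtain ⟨φ, hφ, hket⟩ := exists_eq_ketbra_of_trace_eq_one hS.isStarProjection_productState_one
    (trace_productState_eq_one hS 1)
  have hgauss : IsGaussian (ketbra φ) := hket ▸ isGaussian_productState h.orthonormal_left
    h.orthonormal_right h.inner_left_right hone
  have hmode : ∀ k, expectation ρ (1 - modeState 1 (majoranaBilin (e k) (f k))) = (1 - l k) / 2 :=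
    fun k => by
      rw [one_sub_modeState, hρ.expectation_modeState,
        expectation_majoranaBilin (.of_nonneg hρ.nonneg), h.map_right, inner_smul_right,
        real_inner_self_eq_norm_sq, h.orthonormal_left.1]
      ring
  have hl_le : ∀ k, l k ≤ 1 := fun k => by
    have hle := expectation_mono hρ.nonneg (sub_nonneg.mpr
      (modeState_mem_Icc (hS.isSelfAdjoint k) (hS.mul_self k) (hone k)).2)
    rw [map_zero, Pi.one_apply, hmode] at hle
    linarith
  refine ⟨φ, ⟨hφ, hgauss⟩, ?_⟩
  calc 1 - expectation ρ (ketbra φ)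
      = expectation ρ (1 - hS.productState 1) := by rw [map_sub, hρ.expectation_one, hket]
    _ ≤ ∑ k, (1 - l k) / 2 := by
      refine (expectation_mono hρ.nonneg (hS.one_sub_productState_le hone)).trans_eq ?_
      simp only [map_sum, Pi.one_apply, hmode]
    _ ≤ ∑ k, 1 / 2 * (1 - l k ^ 2) := Finset.sum_le_sum fun k _ => by nlinarith [hl k, hl_le k]
    _ = 1 / 2 * FAF 1 ρ := by rw [FAF_one_eq_sum h, Finset.mul_sum]

end Overlap

/-! ### The closest pure Gaussian state -/

section ClosestState

variable {n : ℕ} {ψ : Ket n}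

theorem isCompact_pureGaussian : IsCompact (pureGaussian n) := by
  have hset : pureGaussian n = Metric.sphere 0 1 ∩ ketbra ⁻¹' {ρ | IsGaussian ρ} := by
    ext φ
    simp [pureGaussian]
  rw [hset]
  exact (isCompact_sphere 0 1).inter_right (isClosed_closure.preimage continuous_ketbra)

theorem isLeast_epsG (hψ : ‖ψ‖ = 1) : IsLeast (gaussianDistances ψ) (epsG ψ) := by
  have himg : gaussianDistances ψ =
      (fun φ => √(1 - expectation (ketbra ψ) (ketbra φ))) '' pureGaussian n := by
    ext d
    refine exists_congr fun φ => and_congr_right fun hφ => ?_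
    rw [traceDist_ketbra hψ hφ.1, eq_comm]
  obtain ⟨φ, hφ, -⟩ := exists_pureGaussian_one_sub_expectation_le (isDensityOperator_ketbra hψ)
  have hcompact : IsCompact (gaussianDistances ψ) := by
    rw [himg]
    exact isCompact_pureGaussian.image (Real.continuous_sqrt.comp
      (continuous_const.sub ((continuous_expectation _).comp continuous_ketbra)))
  exact hcompact.isLeast_sInf ⟨_, φ, hφ, rfl⟩

theorem traceDist_ketbra_sq (hψ : ‖ψ‖ = 1) {φ : Ket n} (hφ : ‖φ‖ = 1) :
    traceDist (ketbra ψ) (ketbra φ) ^ 2 = 1 - expectation (ketbra ψ) (ketbra φ) := by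
  rw [traceDist_ketbra hψ hφ, Real.sq_sqrt
    (sub_nonneg.mpr (expectation_ketbra_le_one (isDensityOperator_ketbra hψ) hφ))]

end ClosestState

end Fermion

/-- The first conjunct says that the minimum defining `ε_G(ψ)` is attained. -/
theorem mainTheorem3 (n : ℕ) (hn : 1 ≤ n) (ψ : Fermion.Ket n) (hψ : ‖ψ‖ = 1) :
    IsLeast (Fermion.gaussianDistances ψ) (Fermion.epsG ψ) ∧
    1 / (4 * (n : ℝ)) * Fermion.FAF 1 (Fermion.ketbra ψ) ≤ Fermion.epsG ψ ^ 2 ∧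
    Fermion.epsG ψ ^ 2 ≤ 1 / 2 * Fermion.FAF 1 (Fermion.ketbra ψ) := by
  have hρ := Fermion.isDensityOperator_ketbra hψ
  have hleast := Fermion.isLeast_epsG hψ
  obtain ⟨φ, hφ, hε⟩ := hleast.1
  have hε_nonneg : 0 ≤ Fermion.epsG ψ := by
    rw [hε, Fermion.traceDist_ketbra hψ hφ.1]
    exact Real.sqrt_nonneg _
  refine ⟨hleast, ?_, ?_⟩
  · have hn_pos : (0 : ℝ) < 4 * n := by positivity
    rw [hε, Fermion.traceDist_ketbra_sq hψ hφ.1, one_div, inv_mul_le_iff₀ hn_pos]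
    exact hφ.2.FAF_one_le hρ
  · obtain ⟨χ, hχ, hle⟩ := Fermion.exists_pureGaussian_one_sub_expectation_le hρ
    rw [← Fermion.traceDist_ketbra_sq hψ hχ.1] at hle
    exact (pow_le_pow_left₀ hε_nonneg (hleast.2 ⟨χ, hχ, rfl⟩) 2).trans hle
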